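/- Let $U\subseteq\mathbb C$ be an open neighbourhood of $0$, let $k:U\to\mathbb R$ be real analytic and positive, and let $\mu(z)=k(z)|z|^2$ for $z\in U$. For $\epsilon>0$ let $E_\epsilon$ be the connected component containing $0$ of $\{z\in U:\mu(z)<\epsilon^2\}$. A normalized univalent map of $E_\epsilon$ onto the disk $|w|<\epsilon$ is an injective holomorphic function $f$ on $E_\epsilon$ with image $\{w\in\mathbb C:|w|<\epsilon\}$, $f(0)=0$ and $f'(0)>0$. Then there are constants $R_1,R_2>0$ (depending only on $\mu$ and its domain $U$), with $\{|z|<R_2\}\subseteq U$, and a holomorphic function $h(\epsilon,z)$ on the polydisk $\{(\epsilon,z)\in\mathbb C^2:|\epsilon|<R_1,\ |z|<R_2\}$ such that for every real $\epsilon$ with $0<\epsilon<R_1$ one has $E_\epsilon=\{z:|z|<R_2,\ \mu(z)<\epsilon^2\}$, and $z\mapsto h(\epsilon,z)$ is the unique normalized univalent map of $E_\epsilon$ onto the disk $|w|<\epsilon$. Moreover $h$ is an even function of $\epsilon$: $h(-\epsilon,z)=h(\epsilon,z)$ for $|\epsilon|<R_1$, $|z|<R_2$. -/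

import Mathlib

open Set

/-- The domain `E_ε` cut out by `μ(z) < ε²` around the origin, for a function `μ` on an open
neighbourhood `U` of `0`: the connected component containing `0` of `{z ∈ U | μ z < ε²}`.
(Far away from `0` the function `μ` may be small again; those parts do not belong to `E_ε`.) -/
def sublevelDomain (U : Set ℂ) (μ : ℂ → ℝ) (ε : ℝ) : Set ℂ :=
  connectedComponentIn {z : ℂ | z ∈ U ∧ μ z < ε ^ 2} 0

/-- `f` is a normalized univalent map of `E` onto the disk `|w| < r`: it is holomorphic and
injective on `E`, has image the disk, and satisfies `f(0) = 0`, `f'(0) > 0`. -/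
structure IsNormalizedUnivalent (f : ℂ → ℂ) (E : Set ℂ) (r : ℝ) : Prop where
  holomorphic : DifferentiableOn ℂ f E
  injective : InjOn f E
  image_eq : f '' E = Metric.ball (0 : ℂ) r
  map_zero : f 0 = 0
  deriv_pos : ∃ c : ℝ, 0 < c ∧ HasDerivAt f (c : ℂ) 0

/-! Put `t = ε²` and `u = log k`. If `X` is holomorphic in `(t, z)` with `u = 2 Re X(t, ·)` on the
curve `e^u |z|² = t`, then `h = z * exp X(ε², z)` has `|h|² = μ = ε²` on the boundary of `E_ε`; it
is even in `ε` because only `ε²` enters.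

To find `X`, treat `z` and `w = z̄` as independent and write `u = a(z, w)`. Every series splits as
`G(z,w) = G(z,0) + G(0,w) - G(0,0) + z w (D G)(z,w)`. The equation `H - t e^{-a} D H = a` is solved
for small `t` by a Neumann series in a space of absolutely convergent series. On `w = z̄` it reads
`u = H(z,0) + H(0,z̄) - H(0,0) + (|z|² - t e^{-u}) D H`, whose last term vanishes on the curve. The
real part of the rest is `2 Re X` (`BidiskSeries.exists_conformal_potential`).

The error term is bounded, so near `0` the conditions `|h| < ε` and `μ < ε²` are equivalent
(`mul_exp_lt_iff`). Up to the factor `exp X(0,0)`, `h` is close to the identity uniformly in small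
`t`, which gives injectivity, the image and connectedness. Uniqueness (`IsNormalizedUnivalent.eqOn`)
is a Schwarz lemma argument. -/

/-! ### Maps close to the identity, and isolation of a connected component. -/

section ApproximatelyIdentity

variable {f : ℂ → ℂ} {R s : ℝ}

theorem ApproximatesLinearOn.norm_le_two_mul_norm
    (hf : ApproximatesLinearOn f (ContinuousLinearMap.id ℂ ℂ) (Metric.ball 0 R) (1 / 2))
    (h0 : f 0 = 0) {z : ℂ} (hz : ‖z‖ < R) : ‖z‖ ≤ 2 * ‖f z‖ := by
  have hR : 0 < R := (norm_nonneg z).trans_lt hz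
  have h := hf z (by simpa using hz) 0 (by simpa using hR)
  simp only [h0, sub_zero, ContinuousLinearMap.id_apply] at h
  have h2 : ‖z‖ ≤ ‖f z‖ + ‖f z - z‖ := by
    simpa using norm_sub_le (f z) (f z - z)
  push_cast at h
  linarith

theorem ApproximatesLinearOn.injOn_ball
    (hf : ApproximatesLinearOn f (ContinuousLinearMap.id ℂ ℂ) (Metric.ball 0 R) (1 / 2)) :
    InjOn f (Metric.ball 0 R) := by
  intro x hx y hy hxy
  have h := hf x hx y hy
  simp only [hxy, sub_self, ContinuousLinearMap.id_apply, zero_sub, norm_neg] at h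
  push_cast at h
  have : ‖x - y‖ = 0 := le_antisymm (by linarith) (norm_nonneg _)
  exact sub_eq_zero.1 (norm_eq_zero.1 this)

theorem ApproximatesLinearOn.ball_subset_image
    (hf : ApproximatesLinearOn f (ContinuousLinearMap.id ℂ ℂ) (Metric.ball 0 R) (1 / 2))
    (h0 : f 0 = 0) (hR : 0 < R) (hs : s ≤ R / 4) :
    Metric.ball 0 s ⊆ f '' Metric.ball 0 R := by
  let g : (ContinuousLinearMap.id ℂ ℂ).NonlinearRightInverse :=
    { toFun := id, nnnorm := 1, bound' := by simp, right_inv' := by intro y; simp }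
  -- The image contains a closed ball of radius `(1 - 1/2) * (R / 2) = R / 4`.
  have h := hf.surjOn_closedBall_of_nonlinearRightInverse g (ε := R / 2) (b := 0) (by positivity)
    (Metric.closedBall_subset_ball (by linarith))
  intro w hw
  obtain ⟨z, hz, rfl⟩ := h (show w ∈ _ by
    simp only [g, h0, mem_closedBall_zero_iff, mem_ball_zero_iff] at hw ⊢
    push_cast
    linarith)
  exact ⟨z, Metric.closedBall_subset_ball (by linarith) hz, rfl⟩

theorem ApproximatesLinearOn.image_sublevel
    (hf : ApproximatesLinearOn f (ContinuousLinearMap.id ℂ ℂ) (Metric.ball 0 R) (1 / 2))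
    (h0 : f 0 = 0) (hR : 0 < R) (hs : s ≤ R / 4) :
    f '' {z | ‖z‖ < R ∧ ‖f z‖ < s} = Metric.ball 0 s := by
  ext w
  constructor
  · rintro ⟨z, hz, rfl⟩
    simpa using hz.2
  · intro hw
    obtain ⟨z, hz, rfl⟩ := hf.ball_subset_image h0 hR hs hw
    exact ⟨z, ⟨by simpa using hz, by simpa using hw⟩, rfl⟩

theorem ApproximatesLinearOn.isPreconnected_sublevel
    (hf : ApproximatesLinearOn f (ContinuousLinearMap.id ℂ ℂ) (Metric.ball 0 R) (1 / 2))
    (h0 : f 0 = 0) (hR : 0 < R) (hs : s ≤ R / 4) :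
    IsPreconnected {z | ‖z‖ < R ∧ ‖f z‖ < s} := by
  have hf' : ApproximatesLinearOn f ((ContinuousLinearEquiv.refl ℂ ℂ : ℂ ≃L[ℂ] ℂ) : ℂ →L[ℂ] ℂ)
    (Metric.ball 0 R) (1 / 2) := hf
  let e := hf'.toOpenPartialHomeomorph f (Metric.ball 0 R) (by
    right
    have : ‖((ContinuousLinearEquiv.refl ℂ ℂ).symm : ℂ →L[ℂ] ℂ)‖₊ = 1 := by
      ext; exact ContinuousLinearMap.norm_id
    rw [this, inv_one]
    exact NNReal.half_lt_self one_ne_zero) Metric.isOpen_ball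
  have hst : Metric.ball (0 : ℂ) s ⊆ e.target := hf.ball_subset_image h0 hR hs
  have key : {z | ‖z‖ < R ∧ ‖f z‖ < s} = e.symm '' Metric.ball 0 s := by
    rw [e.symm.image_eq_target_inter_inv_preimage hst]
    ext z
    simp [e]
  rw [key]
  exact (convex_ball (0 : ℂ) s).isPreconnected.image _ (e.continuousOn_symm.mono hst)

end ApproximatelyIdentity

/-- `V` and `Kᶜ` are open, cover the space, and do not meet inside `F`, so a connected subset of `F`
that meets `V` cannot leave it. This discards the distant pieces where `μ` is small again. -/
theorem connectedComponentIn_eq_inter_of_subset_isClosed {α : Type*} [TopologicalSpace α]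
    {F V K : Set α} {x : α} (hV : IsOpen V) (hK : IsClosed K) (hx : x ∈ F ∩ V)
    (hS : IsPreconnected (F ∩ V)) (hSK : F ∩ V ⊆ K) (hKV : K ⊆ V) :
    connectedComponentIn F x = F ∩ V := by
  apply Subset.antisymm _ (hS.subset_connectedComponentIn hx inter_subset_left)
  refine subset_inter (connectedComponentIn_subset F x) ?_
  by_contra hcon
  obtain ⟨y, hy, hyV⟩ := not_subset.1 hcon
  have hF := connectedComponentIn_subset F x
  obtain ⟨z, hz, hzV, hzK⟩ := isPreconnected_connectedComponentIn (F := F) (x := x) V Kᶜ hV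
    hK.isOpen_compl (fun z _ => (em (z ∈ K)).imp (fun h => hKV h) id)
    ⟨x, mem_connectedComponentIn hx.1, hx.2⟩ ⟨y, hy, fun h => hyV (hKV h)⟩
  exact hzK (hSK ⟨hF hz, hzV⟩)

/-! ### Uniqueness of the normalized univalent map. -/

section Uniqueness

variable {E : Set ℂ} {f g : ℂ → ℂ} {r : ℝ}

namespace IsNormalizedUnivalent

theorem isOpen_image (hE : IsOpen E) (hE' : IsPreconnected E) (h0 : (0 : ℂ) ∈ E)
    (hg : IsNormalizedUnivalent g E r) {s : Set ℂ} (hs : s ⊆ E) (hs' : IsOpen s) :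
    IsOpen (g '' s) := by
  refine ((hg.holomorphic.analyticOnNhd hE).is_constant_or_isOpen hE').resolve_left ?_ s hs hs'
  rintro ⟨w, hw⟩
  obtain ⟨c, hc, hd⟩ := hg.deriv_pos
  have hd' : HasDerivAt g 0 0 := (hasDerivAt_const (0 : ℂ) w).congr_of_eventuallyEq
    (Filter.eventually_of_mem (hE.mem_nhds h0) hw)
  exact hc.ne' (by exact_mod_cast hd.unique hd')

/-- By the open mapping theorem the inverse of `g` is continuous, so this set is the continuous
image of a closed disk. It lets the maximum principle run without any regularity of the boundary of
`E`. -/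
theorem isCompact_norm_le (hE : IsOpen E) (hE' : IsPreconnected E) (h0 : (0 : ℂ) ∈ E)
    (hg : IsNormalizedUnivalent g E r) {ρ : ℝ} (hρ : ρ < r) :
    IsCompact {z ∈ E | ‖g z‖ ≤ ρ} := by
  have hleft : LeftInvOn (Function.invFunOn g E) g E := hg.injective.leftInvOn_invFunOn
  have hball : ∀ w ∈ Metric.ball (0 : ℂ) r, w ∈ g '' E := fun w hw => hg.image_eq ▸ hw
  have hcont : ContinuousOn (Function.invFunOn g E) (Metric.ball 0 r) := by
    refine continuousOn_iff'.2 fun O hO => ⟨g '' (O ∩ E),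
      hg.isOpen_image hE hE' h0 inter_subset_right (hO.inter hE), ?_⟩
    ext w
    simp only [mem_inter_iff, mem_preimage, and_congr_left_iff]
    intro hw
    obtain ⟨z, hz, rfl⟩ := hball w hw
    rw [hleft hz]
    constructor
    · exact fun h => ⟨z, ⟨h, hz⟩, rfl⟩
    · rintro ⟨y, ⟨hyO, hyE⟩, hyz⟩
      exact hg.injective hyE hz hyz ▸ hyO
  have key : {z ∈ E | ‖g z‖ ≤ ρ} = Function.invFunOn g E '' Metric.closedBall 0 ρ := by
    ext z
    constructor
    · rintro ⟨hz, hzρ⟩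
      exact ⟨g z, by simpa using hzρ, hleft hz⟩
    · rintro ⟨w, hw, rfl⟩
      obtain ⟨z, hz, rfl⟩ := hball w (Metric.closedBall_subset_ball hρ hw)
      rw [hleft hz]
      exact ⟨hz, by simpa using hw⟩
  rw [key]
  exact (isCompact_closedBall (0 : ℂ) ρ).image_of_continuousOn
    (hcont.mono (Metric.closedBall_subset_ball hρ))

theorem dslope_eq (hg : IsNormalizedUnivalent g E r) {z : ℂ} (hz : z ≠ 0) :
    dslope g 0 z = z⁻¹ * g z := by
  rw [dslope_of_ne _ hz, slope_def_field, hg.map_zero, sub_zero, sub_zero, div_eq_inv_mul]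

theorem dslope_ne_zero (h0 : (0 : ℂ) ∈ E) (hg : IsNormalizedUnivalent g E r) {z : ℂ}
    (hz : z ∈ E) : dslope g 0 z ≠ 0 := by
  rcases eq_or_ne z 0 with rfl | hz0
  · obtain ⟨c, hc, hd⟩ := hg.deriv_pos
    rw [dslope_same, hd.deriv]
    exact_mod_cast hc.ne'
  · rw [hg.dslope_eq hz0]
    refine mul_ne_zero (inv_ne_zero hz0) fun h => hz0 (hg.injective hz h0 ?_)
    rw [h, hg.map_zero]

theorem differentiableOn_dslope_div (hE : IsOpen E) (h0 : (0 : ℂ) ∈ E)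
    (hf : IsNormalizedUnivalent f E r) (hg : IsNormalizedUnivalent g E r) :
    DifferentiableOn ℂ (fun z => dslope f 0 z / dslope g 0 z) E :=
  ((Complex.differentiableOn_dslope (hE.mem_nhds h0)).2 hf.holomorphic).div
    ((Complex.differentiableOn_dslope (hE.mem_nhds h0)).2 hg.holomorphic)
    fun _ hz => hg.dslope_ne_zero h0 hz

theorem norm_lt (hf : IsNormalizedUnivalent f E r) {z : ℂ} (hz : z ∈ E) : ‖f z‖ < r := by
  have : f z ∈ Metric.ball (0 : ℂ) r := hf.image_eq ▸ mem_image_of_mem f hz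
  simpa using this

/-- The quotient is `f / g` with its singularity at `0` removed. On `|g| = ρ` it is at most `r / ρ`;
apply the maximum principle inside and let `ρ` approach `r`. -/
theorem norm_dslope_div_le (hE : IsOpen E) (hE' : IsPreconnected E) (h0 : (0 : ℂ) ∈ E)
    (hf : IsNormalizedUnivalent f E r) (hg : IsNormalizedUnivalent g E r) {z : ℂ} (hz : z ∈ E) :
    ‖dslope f 0 z / dslope g 0 z‖ ≤ 1 := by
  have hr : 0 < r := (norm_nonneg _).trans_lt (hf.norm_lt hz)
  by_contra! hcon
  set q : ℂ → ℂ := fun z => dslope f 0 z / dslope g 0 z with hq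
  change 1 < ‖q z‖ at hcon
  obtain ⟨ρ, hρ, hρr⟩ := exists_between (max_lt (hg.norm_lt hz) (div_lt_self hr hcon))
  have hgρ : ‖g z‖ < ρ := (le_max_left _ _).trans_lt hρ
  have hρ0 : 0 < ρ := (norm_nonneg _).trans_lt hgρ
  have hK := hg.isCompact_norm_le hE hE' h0 hρr
  set W := {z ∈ E | ‖g z‖ < ρ} with hW
  have hWo : IsOpen W := by
    have := hg.holomorphic.continuousOn.norm.isOpen_inter_preimage hE (isOpen_Iio (a := ρ))
    exact this
  have hWK : W ⊆ {z ∈ E | ‖g z‖ ≤ ρ} := fun z hz => ⟨hz.1, hz.2.le⟩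
  have hcl : closure W ⊆ {z ∈ E | ‖g z‖ ≤ ρ} := closure_minimal hWK hK.isClosed
  have hd : DifferentiableOn ℂ q (closure W) :=
    (differentiableOn_dslope_div hE h0 hf hg).mono fun z hz => (hcl hz).1
  have hle := Complex.norm_le_of_forall_mem_frontier_norm_le (f := q) (C := r / ρ)
    (hK.isBounded.subset hWK) hd.diffContOnCl (by
      intro y hy
      rw [hWo.frontier_eq] at hy
      have hyK := hcl hy.1
      have hyρ : ‖g y‖ = ρ := le_antisymm hyK.2 (not_lt.1 fun h => hy.2 ⟨hyK.1, h⟩)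
      have hy0 : y ≠ 0 := by
        rintro rfl
        rw [hg.map_zero, norm_zero] at hyρ
        exact hρ0.ne hyρ
      simp only [hq]
      rw [hf.dslope_eq hy0, hg.dslope_eq hy0, mul_div_mul_left _ _ (inv_ne_zero hy0), norm_div, hyρ]
      gcongr
      exact (hf.norm_lt hyK.1).le) (subset_closure (show z ∈ W from ⟨hz, hgρ⟩))
  have h1 : r / ‖q z‖ < ρ := (le_max_right _ _).trans_lt hρ
  rw [div_lt_iff₀ (by linarith)] at h1
  rw [le_div_iff₀ hρ0] at hle
  linarith [mul_comm ρ ‖q z‖]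

/-- The bound for `f / g` and for `g / f` forces modulus `1` at `0`, an interior maximum. So `f / g`
is constant, and positive derivatives make the constant `1`. -/
theorem eqOn (hE : IsOpen E) (hE' : IsPreconnected E) (h0 : (0 : ℂ) ∈ E)
    (hf : IsNormalizedUnivalent f E r) (hg : IsNormalizedUnivalent g E r) : EqOn f g E := by
  have hone : ‖dslope f 0 0 / dslope g 0 0‖ = 1 := by
    refine le_antisymm (norm_dslope_div_le hE hE' h0 hf hg h0) ?_
    have := norm_dslope_div_le hE hE' h0 hg hf h0
    rw [← inv_div, norm_inv] at this
    exact (inv_le_one₀ (norm_pos_iff.2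
      (div_ne_zero (hf.dslope_ne_zero h0 h0) (hg.dslope_ne_zero h0 h0)))).1 this
  have hconst := Complex.eqOn_of_isPreconnected_of_isMaxOn_norm hE' hE
    (differentiableOn_dslope_div hE h0 hf hg) h0
    (fun z hz => (norm_dslope_div_le hE hE' h0 hf hg hz).trans hone.ge)
  have hval : dslope f 0 0 / dslope g 0 0 = 1 := by
    obtain ⟨a, ha, hfd⟩ := hf.deriv_pos
    obtain ⟨b, hb, hgd⟩ := hg.deriv_pos
    rw [dslope_same, dslope_same, hfd.deriv, hgd.deriv] at hone ⊢
    rw [← Complex.ofReal_div, Complex.norm_real, Real.norm_of_nonneg (by positivity)] at hone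
    rw [← Complex.ofReal_div, hone, Complex.ofReal_one]
  intro z hz
  rcases eq_or_ne z 0 with rfl | hz0
  · rw [hf.map_zero, hg.map_zero]
  have h := hconst hz
  simp only [Function.const, hval] at h
  rw [div_eq_one_iff_eq (hg.dslope_ne_zero h0 hz), hf.dslope_eq hz0, hg.dslope_eq hz0] at h
  exact mul_left_cancel₀ (inv_ne_zero hz0) h

end IsNormalizedUnivalent

end Uniqueness

/-! ### The space `ℓ¹` and operators prescribed on its unit vectors. -/

section SummableSequences



/-- Absolutely summable complex families. -/
noncomputable abbrev AbsSummable (ι : Type*) := lp (fun _ : ι => ℂ) 1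

namespace AbsSummable

variable {ι W : Type*} [NormedAddCommGroup W] [NormedSpace ℂ W]

theorem hasSum_norm (a : AbsSummable ι) : HasSum (fun i => ‖a i‖) ‖a‖ := by
  simpa using lp.hasSum_norm (p := 1) (by simp) a

theorem norm_tsum_smul_le {v : ι → W} {C : ℝ} (hv : ∀ i, ‖v i‖ ≤ C) (a : AbsSummable ι) :
    ‖∑' i, a i • v i‖ ≤ C * ‖a‖ := by
  rw [mul_comm]
  refine tsum_of_norm_bounded ((hasSum_norm a).mul_right C) fun i => ?_
  rw [norm_smul]
  gcongr
  exact hv i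

section Unit

variable [DecidableEq ι]

/-- The standard unit vectors. -/
noncomputable def unit (i : ι) : AbsSummable ι := lp.single 1 i (1 : ℂ)

theorem norm_unit (i : ι) : ‖unit i‖ = 1 := by
  simp [unit, lp.norm_single]

theorem hasSum_smul_unit (a : AbsSummable ι) : HasSum (fun i => a i • unit i) a := by
  convert lp.hasSum_single (p := 1) (by simp) a using 2 with i
  rw [unit, ← lp.single_smul]
  simp

theorem continuousLinearMap_ext {A B : AbsSummable ι →L[ℂ] W}
    (h : ∀ i, A (unit i) = B (unit i)) : A = B := by
  ext1 a
  refine ((hasSum_smul_unit a).mapL A).unique ?_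
  simpa [map_smul, h] using (hasSum_smul_unit a).mapL B

end Unit

variable [CompleteSpace W]

theorem summable_smul {v : ι → W} {C : ℝ} (hv : ∀ i, ‖v i‖ ≤ C) (a : AbsSummable ι) :
    Summable fun i => a i • v i := by
  refine .of_norm_bounded ((hasSum_norm a).summable.mul_right C) fun i => ?_
  rw [norm_smul]
  gcongr
  exact hv i

open Classical in
/-- The continuous linear map sending the unit vectors to a given bounded family (and `0` if the
family is not bounded). -/
noncomputable def lift (v : ι → W) : AbsSummable ι →L[ℂ] W :=
  if h : ∃ C, 0 ≤ C ∧ ∀ i, ‖v i‖ ≤ C then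
    LinearMap.mkContinuous
      { toFun := fun a => ∑' i, a i • v i
        map_add' := fun a b => by
          rw [← (summable_smul h.choose_spec.2 a).tsum_add (summable_smul h.choose_spec.2 b)]
          simp [add_smul]
        map_smul' := fun c a => by
          rw [RingHom.id_apply, ← (summable_smul h.choose_spec.2 a).tsum_const_smul]
          simp [mul_smul] }
      h.choose (norm_tsum_smul_le h.choose_spec.2)
  else 0

theorem lift_apply {v : ι → W} {C : ℝ} (hv : ∀ i, ‖v i‖ ≤ C) (a : AbsSummable ι) :
    lift v a = ∑' i, a i • v i := by
  have h : ∃ C, 0 ≤ C ∧ ∀ i, ‖v i‖ ≤ C :=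
    ⟨max C 0, le_max_right _ _, fun i => (hv i).trans (le_max_left _ _)⟩
  rw [lift, dif_pos h]
  rfl

theorem norm_lift_le {v : ι → W} {C : ℝ} (hC : 0 ≤ C) (hv : ∀ i, ‖v i‖ ≤ C) :
    ‖lift v‖ ≤ C := by
  refine ContinuousLinearMap.opNorm_le_bound _ hC fun a => ?_
  rw [lift_apply hv]
  exact norm_tsum_smul_le hv a

theorem lift_unit [DecidableEq ι] {v : ι → W} {C : ℝ} (hv : ∀ i, ‖v i‖ ≤ C) (i : ι) :
    lift v (unit i) = v i := by
  rw [lift_apply hv, tsum_eq_single i]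
  · simp [unit]
  · intro j hj
    simp [unit, lp.single_apply, hj]

end AbsSummable

end SummableSequences

/-! ### The Banach space of bidisk series: evaluation, division, product, exponential. -/

/-- Coefficients of absolutely convergent power series on the closed unit bidisk. -/
noncomputable abbrev BidiskSeries := AbsSummable (ℕ × ℕ)

namespace BidiskSeries

open AbsSummable

/-- Evaluation of a series at a point of the closed unit bidisk. -/
noncomputable def eval (z w : ℂ) : BidiskSeries →L[ℂ] ℂ := lift fun i => z ^ i.1 * w ^ i.2

theorem norm_monomial_le {z w : ℂ} (hz : ‖z‖ ≤ 1) (hw : ‖w‖ ≤ 1) (i : ℕ × ℕ) :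
    ‖z ^ i.1 * w ^ i.2‖ ≤ 1 := by
  rw [norm_mul, norm_pow, norm_pow]
  exact mul_le_one₀ (pow_le_one₀ (norm_nonneg _) hz) (by positivity)
    (pow_le_one₀ (norm_nonneg _) hw)

theorem eval_unit {z w : ℂ} (hz : ‖z‖ ≤ 1) (hw : ‖w‖ ≤ 1) (i : ℕ × ℕ) :
    eval z w (unit i) = z ^ i.1 * w ^ i.2 :=
  lift_unit (norm_monomial_le hz hw) i

theorem norm_eval_le {z w : ℂ} (hz : ‖z‖ ≤ 1) (hw : ‖w‖ ≤ 1) : ‖eval z w‖ ≤ 1 :=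
  norm_lift_le zero_le_one (norm_monomial_le hz hw)

theorem norm_eval_apply_le {z w : ℂ} (hz : ‖z‖ ≤ 1) (hw : ‖w‖ ≤ 1) (a : BidiskSeries) :
    ‖eval z w a‖ ≤ ‖a‖ :=
  ((eval z w).le_of_opNorm_le (norm_eval_le hz hw) a).trans_eq (one_mul _)

/-- The operator `G ↦ (G(z,w) - G(z,0) - G(0,w) + G(0,0)) / (z w)`. -/
noncomputable def diagonalQuotient : BidiskSeries →L[ℂ] BidiskSeries :=
  lift fun i => if 1 ≤ i.1 ∧ 1 ≤ i.2 then unit (i.1 - 1, i.2 - 1) else 0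

theorem diagonalQuotient_unit (i : ℕ × ℕ) : diagonalQuotient (unit i) =
    if 1 ≤ i.1 ∧ 1 ≤ i.2 then unit (i.1 - 1, i.2 - 1) else 0 :=
  lift_unit (C := 1) (fun i => by split_ifs <;> simp [norm_unit]) i

theorem eval_eq_add_diagonalQuotient {z w : ℂ} (hz : ‖z‖ ≤ 1) (hw : ‖w‖ ≤ 1) (a : BidiskSeries) :
    eval z w a =
      eval z 0 a + eval 0 w a - eval 0 0 a + z * w * eval z w (diagonalQuotient a) := by
  have h0 : ‖(0 : ℂ)‖ ≤ 1 := by simp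
  have key : eval z w =
      eval z 0 + eval 0 w - eval 0 0 + (z * w) • (eval z w).comp diagonalQuotient := by
    refine continuousLinearMap_ext fun i => ?_
    simp only [add_apply, sub_apply, smul_apply,
      ContinuousLinearMap.comp_apply, eval_unit hz hw,
      eval_unit hz h0, eval_unit h0 hw, eval_unit h0 h0, diagonalQuotient_unit]
    obtain ⟨i, j⟩ := i
    rcases i with _ | i <;> rcases j with _ | j <;> simp [eval_unit hz hw]
    ring
  exact DFunLike.congr_fun key a

/-- The Cauchy product of series. -/
noncomputable def mul : BidiskSeries →L[ℂ] BidiskSeries →L[ℂ] BidiskSeries :=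
  lift fun i => lift fun j => unit (i + j)

theorem norm_shift_le (i : ℕ × ℕ) :
    ‖(lift fun j => unit (i + j) : BidiskSeries →L[ℂ] BidiskSeries)‖ ≤ 1 :=
  norm_lift_le zero_le_one fun _ => (norm_unit _).le

theorem mul_unit_unit (i j : ℕ × ℕ) : mul (unit i) (unit j) = unit (i + j) := by
  rw [mul, lift_unit norm_shift_le, lift_unit fun j => (norm_unit (i + j)).le]

theorem norm_mul_le (a b : BidiskSeries) : ‖mul a b‖ ≤ ‖a‖ * ‖b‖ := by
  have h : ‖mul‖ ≤ 1 := norm_lift_le zero_le_one norm_shift_le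
  have := mul.le_of_opNorm₂_le_of_le h le_rfl le_rfl (x := a) (y := b)
  simpa using this

theorem eval_mul {z w : ℂ} (hz : ‖z‖ ≤ 1) (hw : ‖w‖ ≤ 1) (a b : BidiskSeries) :
    eval z w (mul a b) = eval z w a * eval z w b := by
  have h1 : ∀ i b, eval z w (mul (unit i) b) = eval z w (unit i) * eval z w b := by
    intro i b
    have : (eval z w).comp (mul (unit i)) = eval z w (unit i) • eval z w :=
      continuousLinearMap_ext fun j => by
        simp [mul_unit_unit, eval_unit hz hw, pow_add]
        ring
    exact DFunLike.congr_fun this b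
  have h2 : (eval z w).comp (mul.flip b) = eval z w b • eval z w :=
    continuousLinearMap_ext fun i => by simp [h1, mul_comm]
  rw [mul_comm]
  exact DFunLike.congr_fun h2 a

theorem eval_exp {z w : ℂ} {A : BidiskSeries →L[ℂ] BidiskSeries} {c : ℂ}
    (h : ∀ a, eval z w (A a) = c * eval z w a) (a : BidiskSeries) :
    eval z w (NormedSpace.exp A a) = Complex.exp c * eval z w a := by
  have hpow : ∀ (n : ℕ) (b : BidiskSeries), eval z w ((A ^ n) b) = c ^ n * eval z w b := by
    intro n
    induction n with
    | zero => simp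
    | succ n ih => intro b; rw [pow_succ', mul_apply_eq_comp, h, ih]; ring
  have h1 := ((NormedSpace.exp_series_hasSum_exp' (𝕂 := ℂ) A).mapL
    (ContinuousLinearMap.apply ℂ BidiskSeries a)).mapL (eval z w)
  have h2 := (NormedSpace.exp_series_hasSum_exp' (𝕂 := ℂ) c).mul_right (eval z w a)
  rw [← Complex.exp_eq_exp_ℂ] at h2
  refine h1.unique (h2.congr_fun fun n => ?_)
  change eval z w ((n.factorial⁻¹ : ℂ) • (A ^ n) a) = _
  rw [map_smul, hpow, smul_eq_mul, smul_eq_mul, mul_assoc]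

theorem differentiableOn_tsum_pow_smul {W : Type*} [NormedAddCommGroup W] [NormedSpace ℂ W]
    [CompleteSpace W] {v : ℕ → W} (hv : ∀ n, ‖v n‖ ≤ 1) :
    DifferentiableOn ℂ (fun z : ℂ => ∑' n, z ^ n • v n) (Metric.ball 0 1) := by
  intro z hz
  rw [mem_ball_zero_iff] at hz
  obtain ⟨ρ, hzρ, hρ⟩ := exists_between hz
  have hρ0 : 0 ≤ ρ := (norm_nonneg _).trans hzρ.le
  have h := Complex.differentiableOn_tsum_of_summable_norm (summable_geometric_of_lt_one hρ0 hρ)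
    (F := fun n (z : ℂ) => z ^ n • v n) (U := Metric.ball 0 ρ)
    (fun n => by fun_prop) Metric.isOpen_ball (fun n y hy => by
      rw [mem_ball_zero_iff] at hy
      rw [norm_smul, norm_pow]
      exact (mul_le_of_le_one_right (by positivity) (hv n)).trans (by gcongr))
  exact (h.differentiableAt (Metric.isOpen_ball.mem_nhds (by simpa using hzρ))).differentiableWithinAt

/-- Here `E z = ∑ z ^ n • v n` in operator norm, with `v n` the coefficient functional at `φ n`.
Analyticity in operator norm allows `E z` to be applied to a series that itself varies with `t`. -/
theorem analyticOnNhd_of_apply_unit {E : ℂ → BidiskSeries →L[ℂ] ℂ} {φ : ℕ → ℕ × ℕ}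
    (hφ : Function.Injective φ) (h1 : ∀ z ∈ Metric.ball (0 : ℂ) 1, ∀ n, E z (unit (φ n)) = z ^ n)
    (h2 : ∀ z ∈ Metric.ball (0 : ℂ) 1, ∀ i ∉ range φ, E z (unit i) = 0) :
    AnalyticOnNhd ℂ E (Metric.ball 0 1) := by
  let v : ℕ → BidiskSeries →L[ℂ] ℂ := fun n => lift fun i => if i = φ n then 1 else 0
  have hv' : ∀ n (i : ℕ × ℕ), ‖(if i = φ n then 1 else 0 : ℂ)‖ ≤ 1 := by
    intro n i; split_ifs <;> simp
  have hv : ∀ n, ‖v n‖ ≤ 1 := fun n => norm_lift_le zero_le_one (hv' n)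
  refine DifferentiableOn.analyticOnNhd ?_ Metric.isOpen_ball
  refine (differentiableOn_tsum_pow_smul hv).congr fun z hz => ?_
  have hz' := mem_ball_zero_iff.1 hz
  have hs : Summable fun n => z ^ n • v n := by
    refine .of_norm_bounded (summable_geometric_of_lt_one (norm_nonneg z) hz') fun n => ?_
    rw [norm_smul, norm_pow]
    exact mul_le_of_le_one_right (by positivity) (hv n)
  refine continuousLinearMap_ext fun i => ?_
  have happ := hs.hasSum.mapL (ContinuousLinearMap.apply ℂ ℂ (unit i))
  simp only [ContinuousLinearMap.apply_apply, smul_apply, v, lift_unit (hv' _)] at happ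
  rw [← happ.tsum_eq]
  by_cases hi : i ∈ range φ
  · obtain ⟨m, rfl⟩ := hi
    rw [h1 z hz, tsum_eq_single m]
    · simp
    · intro n hn
      rw [if_neg fun h => hn (hφ h).symm, smul_zero]
  · rw [h2 z hz i hi]
    refine (tsum_zero.symm.trans (tsum_congr fun n => ?_))
    rw [if_neg fun h => hi ⟨n, h.symm⟩, smul_zero]

theorem analyticOnNhd_eval_left : AnalyticOnNhd ℂ (fun z => eval z 0) (Metric.ball 0 1) := by
  refine analyticOnNhd_of_apply_unit (φ := fun n => (n, 0)) (fun m n h => congrArg Prod.fst h)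
    (fun z hz n => ?_) fun z hz i hi => ?_
  all_goals rw [mem_ball_zero_iff] at hz
  · simp [eval_unit hz.le]
  · obtain ⟨i, _ | j⟩ := i
    · exact absurd ⟨i, rfl⟩ hi
    · simp [eval_unit hz.le]

theorem analyticOnNhd_eval_right : AnalyticOnNhd ℂ (fun w => eval 0 w) (Metric.ball 0 1) := by
  refine analyticOnNhd_of_apply_unit (φ := fun n => (0, n)) (fun m n h => congrArg Prod.snd h)
    (fun z hz n => ?_) fun z hz i hi => ?_
  all_goals rw [mem_ball_zero_iff] at hz
  · simp [eval_unit _ hz.le]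
  · obtain ⟨_ | i, j⟩ := i
    · exact absurd ⟨j, rfl⟩ hi
    · simp [eval_unit _ hz.le]

/-! ### Real analytic functions as series in `z` and its conjugate. -/

open scoped ComplexConjugate

/-- Writing `x = (z + z̄) / 2` and `y = (z - z̄) / (2 i)` turns a real homogeneous polynomial in
`x`, `y` into a polynomial in `z`, `z̄`. -/
theorem exists_eval_conj_eq_multilinear (n : ℕ)
    (q : ContinuousMultilinearMap ℝ (fun _ : Fin n => ℂ) ℝ) :
    ∃ a : BidiskSeries, ‖a‖ ≤ 2 ^ n * ‖q‖ ∧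
      ∀ z : ℂ, ‖z‖ ≤ 1 → eval z (conj z) a = (q fun _ => z : ℝ) := by
  induction n with
  | zero =>
    refine ⟨((q 0 : ℝ) : ℂ) • unit 0, ?_, fun z hz => ?_⟩
    · rw [norm_smul, norm_unit, Complex.norm_real, mul_one, pow_zero, one_mul]
      exact (q.le_opNorm 0).trans_eq (by simp)
    · rw [map_smul, eval_unit hz (by simpa using hz), Subsingleton.elim (fun _ : Fin 0 => z) 0]
      simp
  | succ n ih =>
    obtain ⟨a, ha, hae⟩ := ih (q.curryLeft 1)
    obtain ⟨b, hb, hbe⟩ := ih (q.curryLeft Complex.I)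
    -- `x` and `y` restrict to `Re z` and `Im z` and have norm at most `1`; the two summands per
    -- degree produce the factor `2 ^ n`.
    set x : BidiskSeries := (1 / 2 : ℂ) • (unit (1, 0) + unit (0, 1)) with hx
    set y : BidiskSeries := (1 / (2 * Complex.I) : ℂ) • (unit (1, 0) - unit (0, 1)) with hy
    have hx1 : ‖x‖ ≤ 1 := by
      have := norm_add_le (unit (1, 0) : BidiskSeries) (unit (0, 1))
      rw [norm_unit, norm_unit] at this
      rw [hx, norm_smul]
      norm_num
      linarith
    have hy1 : ‖y‖ ≤ 1 := by
      have := norm_sub_le (unit (1, 0) : BidiskSeries) (unit (0, 1))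
      rw [norm_unit, norm_unit] at this
      rw [hy, norm_smul]
      norm_num
      linarith
    refine ⟨mul x a + mul y b, ?_, fun z hz => ?_⟩
    · have h1 : ‖q.curryLeft 1‖ ≤ ‖q‖ := by
        simpa using (q.curryLeft).le_opNorm 1
      have h2 : ‖q.curryLeft Complex.I‖ ≤ ‖q‖ := by
        simpa using (q.curryLeft).le_opNorm Complex.I
      calc ‖mul x a + mul y b‖ ≤ ‖x‖ * ‖a‖ + ‖y‖ * ‖b‖ :=
            (norm_add_le _ _).trans (add_le_add (norm_mul_le _ _) (norm_mul_le _ _))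
        _ ≤ 1 * (2 ^ n * ‖q‖) + 1 * (2 ^ n * ‖q‖) := by
            gcongr
            · exact ha.trans (by gcongr)
            · exact hb.trans (by gcongr)
        _ = 2 ^ (n + 1) * ‖q‖ := by ring
    · have hz' : ‖conj z‖ ≤ 1 := by simpa using hz
      have hxe : eval z (conj z) x = z.re := by
        rw [hx, map_smul, map_add, eval_unit hz hz', eval_unit hz hz']
        simp only [pow_one, pow_zero, mul_one, one_mul, Complex.add_conj, smul_eq_mul]
        push_cast
        ring
      have hye : eval z (conj z) y = z.im := by
        rw [hy, map_smul, map_sub, eval_unit hz hz', eval_unit hz hz']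
        simp only [pow_one, pow_zero, mul_one, one_mul, Complex.sub_conj, smul_eq_mul]
        push_cast
        field_simp
      rw [map_add, eval_mul hz hz', eval_mul hz hz', hxe, hye, hae z hz, hbe z hz]
      have hq : (q fun _ => z) = q.curryLeft z fun _ => z := by
        rw [ContinuousMultilinearMap.curryLeft_apply]
        congr 1
        ext i
        refine Fin.cases ?_ (fun i => ?_) i <;> simp
      have hzc : z = z.re • (1 : ℂ) + z.im • Complex.I := by
        simp [Complex.re_add_im]
      have hlin : q.curryLeft z = z.re • q.curryLeft 1 + z.im • q.curryLeft Complex.I := by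
        conv_lhs => rw [hzc]
        rw [map_add, map_smul, map_smul]
      rw [hq, hlin]
      simp

theorem exists_eval_conj_eq_of_analyticAt {u : ℂ → ℝ} (hu : AnalyticAt ℝ u 0) :
    ∃ r : ℝ, 0 < r ∧ ∃ a : BidiskSeries,
      ∀ z : ℂ, ‖z‖ ≤ 1 → eval z (conj z) a = (u (r * z) : ℝ) := by
  obtain ⟨p, R, hp⟩ := hu
  obtain ⟨ρ, hρ0, hρ⟩ := ENNReal.lt_iff_exists_nnreal_btwn.1 hp.r_pos
  have hρ0' : 0 < ρ := by exact_mod_cast hρ0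
  choose c hc hce using fun n => exists_eval_conj_eq_multilinear n (p n)
  have hs : Summable fun n => ((ρ / 2 : ℝ) : ℂ) ^ n • c n := by
    refine .of_norm_bounded (p.summable_norm_mul_pow (hρ.trans_le hp.r_le)) fun n => ?_
    rw [norm_smul, norm_pow, Complex.norm_real, Real.norm_of_nonneg (by positivity)]
    calc ((ρ : ℝ) / 2) ^ n * ‖c n‖ ≤ (ρ / 2) ^ n * (2 ^ n * ‖p n‖) := by gcongr; exact hc n
      _ = ‖p n‖ * ρ ^ n := by rw [div_pow]; field_simp
  -- Halving the radius absorbs the factor `2 ^ n` in the bound on `c n`.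
  refine ⟨ρ / 2, by positivity, ∑' n, ((ρ / 2 : ℝ) : ℂ) ^ n • c n, fun z hz => ?_⟩
  have h1 := hs.hasSum.mapL (eval z (conj z))
  have hmem : ((ρ / 2 : ℝ) : ℂ) * z ∈ Metric.eball (0 : ℂ) R := by
    refine Metric.eball_subset_eball hρ.le ?_
    rw [Metric.eball_coe, mem_ball_zero_iff, norm_mul, Complex.norm_real,
      Real.norm_of_nonneg (by positivity)]
    have : (0 : ℝ) < ρ := hρ0'
    nlinarith
  have h2 := (hp.hasSum hmem).mapL Complex.ofRealCLM
  refine h1.unique ?_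
  rw [zero_add] at h2
  simp only [Complex.ofRealCLM_apply] at h2
  convert h2 using 2 with n
  rw [map_smul, hce n z hz]
  have : (p n fun _ => ((ρ / 2 : ℝ) : ℂ) * z) = (ρ / 2 : ℝ) ^ n * p n fun _ => z := by
    have := (p n).map_smul_univ (fun _ => (ρ / 2 : ℝ)) (fun _ => z)
    simpa [div_pow] using this
  rw [this]
  simp

end BidiskSeries

/-! ### Construction of the conformal potential `X`. -/

open scoped ComplexConjugate Topology

/-- Reflection keeps `X` holomorphic when an antiholomorphic term is traded for its conjugate:
conjugating on both sides makes the derivative complex linear again. -/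
theorem HasStrictFDerivAt.conj_conj {f : ℂ × ℂ → ℂ} {f' : ℂ × ℂ →L[ℂ] ℂ} {p : ℂ × ℂ}
    (hf : HasStrictFDerivAt f f' (conj p.1, conj p.2)) :
    HasStrictFDerivAt (fun p : ℂ × ℂ => conj (f (conj p.1, conj p.2)))
      ((starL ℂ).toContinuousLinearMap.comp (f'.comp (starL ℂ).toContinuousLinearMap)) p := by
  refine .of_isLittleO ?_
  have htend : Filter.Tendsto (fun x : (ℂ × ℂ) × (ℂ × ℂ) => (star x.1, star x.2)) (𝓝 (p, p))
      (𝓝 (star p, star p)) := (continuous_star.prodMap continuous_star).tendsto _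
  refine (Asymptotics.isLittleO_norm_norm.1 ?_)
  refine ((hf.isLittleO.comp_tendsto htend).norm_norm).congr (fun x => ?_) fun x => ?_
  · simp only [Function.comp_apply]
    rw [← Complex.norm_conj]
    simp only [map_sub]
    rfl
  · simp only [Function.comp_apply, ← star_sub, norm_star]

namespace BidiskSeries

open AbsSummable

theorem exists_conformal_potential {u : ℂ → ℝ} {a : BidiskSeries}
    (ha : ∀ z : ℂ, ‖z‖ ≤ 1 → eval z (conj z) a = (u z : ℝ)) :
    ∃ δ C : ℝ, 0 < δ ∧ ∃ X : ℂ × ℂ → ℂ,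
      (∀ p ∈ Metric.ball (0 : ℂ) δ ×ˢ Metric.ball (0 : ℂ) 1, ∃ X' : ℂ × ℂ →L[ℂ] ℂ, HasStrictFDerivAt X X' p) ∧
      (∀ t : ℝ, (X (t, 0)).im = 0) ∧
      ∀ t : ℝ, |t| < δ → ∀ z : ℂ, ‖z‖ < 1 → ∃ q : ℝ, |q| ≤ C ∧
        u z = 2 * (X (t, z)).re + (Real.exp (u z) * ‖z‖ ^ 2 - t) * q := by
  set M : BidiskSeries →L[ℂ] BidiskSeries := NormedSpace.exp (-mul a) with hM
  set T : BidiskSeries →L[ℂ] BidiskSeries := M.comp diagonalQuotient with hT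
  set H : ℂ → BidiskSeries := fun t => Ring.inverse (1 - t • T) a with hH
  -- Makes `‖t • T‖ ≤ 1 / 2`, so that `1 - t • T` is invertible and `‖H t‖ ≤ 2 * ‖a‖`.
  set δ : ℝ := 1 / (2 * (‖T‖ + 1)) with hδ
  have hTpos : 0 < ‖T‖ + 1 := by positivity
  have hδ0 : 0 < δ := by positivity
  have hsmall : ∀ t ∈ Metric.ball (0 : ℂ) δ, ‖t • T‖ ≤ 1 / 2 := by
    intro t ht
    rw [mem_ball_zero_iff] at ht
    rw [norm_smul]
    calc ‖t‖ * ‖T‖ ≤ δ * (‖T‖ + 1) := by gcongr; linarith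
      _ = 1 / 2 := by rw [hδ]; field_simp
  have hunit : ∀ t ∈ Metric.ball (0 : ℂ) δ, IsUnit (1 - t • T) := fun t ht =>
    isUnit_one_sub_of_norm_lt_one ((hsmall t ht).trans_lt (by norm_num))
  have hHeq : ∀ t ∈ Metric.ball (0 : ℂ) δ, a = H t - t • T (H t) := by
    intro t ht
    have h := DFunLike.congr_fun (Ring.mul_inverse_cancel _ (hunit t ht)) a
    exact h.symm
  have hHnorm : ∀ t ∈ Metric.ball (0 : ℂ) δ, ‖H t‖ ≤ 2 * ‖a‖ := by
    intro t ht
    have h1 : ‖(t • T) (H t)‖ ≤ 1 / 2 * ‖H t‖ := (t • T).le_of_opNorm_le (hsmall t ht) _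
    have h2 : ‖H t‖ ≤ ‖a‖ + ‖(t • T) (H t)‖ := by
      have h3 : H t = a + (t • T) (H t) := by
        conv_rhs => rw [hHeq t ht]
        simp
      conv_lhs => rw [h3]
      exact norm_add_le _ _
    linarith
  have hHan : AnalyticOnNhd ℂ H (Metric.ball 0 δ) := by
    refine DifferentiableOn.analyticOnNhd (fun t ht => ?_) Metric.isOpen_ball
    have h1 : DifferentiableAt ℂ (fun w : ℂ => 1 - w • T) t := by fun_prop
    have h2 : DifferentiableAt ℂ (fun w : ℂ => Ring.inverse (1 - w • T)) t :=
      DifferentiableAt.comp (g := Ring.inverse) t (differentiableAt_inverse (𝕜 := ℂ) (hunit t ht)) h1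
    exact (h2.clm_apply (differentiableAt_const a)).differentiableWithinAt
  set P : ℂ × ℂ → ℂ := fun p => eval p.2 0 (H p.1) with hP
  set Q : ℂ × ℂ → ℂ := fun p => eval 0 p.2 (H p.1) with hQ
  have hPs : ∀ p ∈ Metric.ball (0 : ℂ) δ ×ˢ Metric.ball (0 : ℂ) 1,
      ∃ P' : ℂ × ℂ →L[ℂ] ℂ, HasStrictFDerivAt P P' p := by
    intro p hp
    have h1 : AnalyticAt ℂ (fun p : ℂ × ℂ => H p.1) p := (hHan p.1 hp.1).comp analyticAt_fst
    have h2 : AnalyticAt ℂ (fun p : ℂ × ℂ => eval p.2 0) p :=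
      (analyticOnNhd_eval_left p.2 hp.2).comp (f := Prod.snd) analyticAt_snd
    exact ⟨_, h2.hasStrictFDerivAt.clm_apply h1.hasStrictFDerivAt⟩
  have hQs : ∀ p ∈ Metric.ball (0 : ℂ) δ ×ˢ Metric.ball (0 : ℂ) 1,
      ∃ Q' : ℂ × ℂ →L[ℂ] ℂ, HasStrictFDerivAt Q Q' p := by
    intro p hp
    have h1 : AnalyticAt ℂ (fun p : ℂ × ℂ => H p.1) p := (hHan p.1 hp.1).comp analyticAt_fst
    have h2 : AnalyticAt ℂ (fun p : ℂ × ℂ => eval 0 p.2) p :=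
      (analyticOnNhd_eval_right p.2 hp.2).comp (f := Prod.snd) analyticAt_snd
    exact ⟨_, h2.hasStrictFDerivAt.clm_apply h1.hasStrictFDerivAt⟩
  -- For real `t`, `2 Re X = Re (H(z,0) + H(0,z̄) - H(0,0))`. Symmetrizing the constant term makes
  -- `X(t, 0)` real, hence `h'(0) > 0`.
  set X : ℂ × ℂ → ℂ := fun p => 1 / 2 * (P p + conj (Q (conj p.1, conj p.2))) -
    1 / 4 * (P (p.1, 0) + conj (P (conj p.1, conj 0))) with hX
  refine ⟨δ, Real.exp ‖a‖ * (‖diagonalQuotient‖ * (2 * ‖a‖)), hδ0, X, ?_, ?_, ?_⟩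
  · intro p hp
    have hmem : ∀ p ∈ Metric.ball (0 : ℂ) δ ×ˢ Metric.ball (0 : ℂ) 1,
        (conj p.1, conj p.2) ∈ Metric.ball (0 : ℂ) δ ×ˢ Metric.ball (0 : ℂ) 1 := by
      intro p hp
      simpa using hp
    have hp0 : (p.1, (0 : ℂ)) ∈ Metric.ball (0 : ℂ) δ ×ˢ Metric.ball (0 : ℂ) 1 :=
      ⟨hp.1, by simp⟩
    obtain ⟨P1, hP1⟩ := hPs p hp
    obtain ⟨Q1, hQ1⟩ := hQs _ (hmem p hp)
    obtain ⟨P2, hP2⟩ := hPs _ hp0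
    obtain ⟨P3, hP3⟩ := hPs _ (hmem _ hp0)
    have hι : HasStrictFDerivAt (fun p : ℂ × ℂ => (p.1, (0 : ℂ)))
      ((ContinuousLinearMap.fst ℂ ℂ ℂ).prod 0) p :=
      hasStrictFDerivAt_fst.prodMk (hasStrictFDerivAt_const _ _)
    have h4 := HasStrictFDerivAt.comp (f := fun p : ℂ × ℂ => (p.1, (0 : ℂ))) p hP2 hι
    have h5 := HasStrictFDerivAt.comp (f := fun p : ℂ × ℂ => (p.1, (0 : ℂ))) p hP3.conj_conj hι
    exact ⟨_, ((hP1.add hQ1.conj_conj).const_mul (1 / 2)).sub ((h4.add h5).const_mul (1 / 4))⟩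
  · intro t
    simp only [hX, hP, hQ, map_zero, Complex.conj_ofReal]
    simp
  · intro t ht z hz
    have htδ : (t : ℂ) ∈ Metric.ball (0 : ℂ) δ := by simpa using ht
    have hz' : ‖conj z‖ ≤ 1 := by simpa using hz.le
    have hu : |u z| ≤ ‖a‖ := by
      have := norm_eval_apply_le hz.le hz' a
      rwa [ha z hz.le, Complex.norm_real] at this
    set d := eval z (conj z) (diagonalQuotient (H t)) with hd
    have hdle : ‖d‖ ≤ ‖diagonalQuotient‖ * (2 * ‖a‖) :=
      (norm_eval_apply_le hz.le hz' _).trans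
        (diagonalQuotient.le_of_opNorm_le_of_le le_rfl (hHnorm t htδ))
    refine ⟨Real.exp (-u z) * d.re, ?_, ?_⟩
    · rw [abs_mul, Real.abs_exp]
      gcongr
      · exact (neg_le_abs _).trans hu
      · exact (Complex.abs_re_le_norm d).trans hdle
    · have hMe : ∀ b, eval z (conj z) (M b) = Complex.exp (-u z) * eval z (conj z) b :=
        eval_exp fun b => by
          rw [neg_apply, map_neg, eval_mul hz.le hz', ha z hz.le, neg_mul]
      have h1 : (u z : ℂ) = eval z (conj z) (H t) - t * (Complex.exp (-u z) * d) := by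
        have h0 := congrArg (eval z (conj z)) (hHeq t htδ)
        rwa [ha z hz.le, map_sub, map_smul, hT, ContinuousLinearMap.comp_apply, hMe,
          smul_eq_mul] at h0
      rw [eval_eq_add_diagonalQuotient hz.le hz', Complex.mul_conj, Complex.normSq_eq_norm_sq,
        ← Complex.ofReal_neg, ← Complex.ofReal_exp] at h1
      have h2 := congrArg Complex.re h1
      simp only [Complex.add_re, Complex.sub_re, Complex.re_ofReal_mul, Complex.ofReal_re] at h2
      have h3 : (X (t, z)).re = 1 / 2 * ((eval z 0 (H t)).re + (eval 0 (conj z) (H t)).re)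
          - 1 / 2 * (eval 0 0 (H t)).re := by
        simp only [hX, hP, hQ, map_zero, Complex.conj_ofReal]
        simp
        ring
      have h4 : Real.exp (u z) * Real.exp (-u z) = 1 := by rw [← Real.exp_add]; simp
      rw [h3]
      linear_combination h2 - ‖z‖ ^ 2 * d.re * h4

end BidiskSeries

theorem AnalyticAt.exists_conformal_potential {u : ℂ → ℝ} (hu : AnalyticAt ℝ u 0) :
    ∃ δ C : ℝ, 0 < δ ∧ ∃ X : ℂ × ℂ → ℂ,
      (∀ p ∈ Metric.ball (0 : ℂ) δ ×ˢ Metric.ball (0 : ℂ) δ, ∃ X' : ℂ × ℂ →L[ℂ] ℂ, HasStrictFDerivAt X X' p) ∧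
      (∀ t : ℝ, (X (t, 0)).im = 0) ∧
      ∀ t : ℝ, |t| < δ → ∀ z : ℂ, ‖z‖ < δ → ∃ q : ℝ, |q| ≤ C ∧
        u z = 2 * (X (t, z)).re + (Real.exp (u z) * ‖z‖ ^ 2 - t) * q := by
  obtain ⟨r, hr, a, ha⟩ := BidiskSeries.exists_eval_conj_eq_of_analyticAt hu
  obtain ⟨δ, C, hδ, X, hX, hX0, hXu⟩ :=
    BidiskSeries.exists_conformal_potential (u := fun z => u (r * z)) ha
  have hscale : ∀ z : ℂ, ‖((r⁻¹ : ℝ) : ℂ) * z‖ = ‖z‖ / r := fun z => by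
    rw [norm_mul, Complex.norm_real, Real.norm_of_nonneg (by positivity), inv_mul_eq_div]
  have hscale2 : ∀ t : ℂ, ‖(((r ^ 2)⁻¹ : ℝ) : ℂ) * t‖ = ‖t‖ / r ^ 2 := fun t => by
    rw [norm_mul, Complex.norm_real, Real.norm_of_nonneg (by positivity), inv_mul_eq_div]
  -- Replacing `z` by `z / r` divides `|z|²` by `r ^ 2`, so `t` must scale by `r ^ 2` too.
  refine ⟨min (r ^ 2 * δ) r, C / r ^ 2, by positivity,
    fun p => X ((((r ^ 2)⁻¹ : ℝ) : ℂ) * p.1, ((r⁻¹ : ℝ) : ℂ) * p.2), ?_, ?_, ?_⟩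
  · rintro p ⟨hp1, hp2⟩
    rw [mem_ball_zero_iff, lt_min_iff] at hp1 hp2
    obtain ⟨X', hX'⟩ := hX ((((r ^ 2)⁻¹ : ℝ) : ℂ) * p.1, ((r⁻¹ : ℝ) : ℂ) * p.2) (by
      rw [mem_prod, mem_ball_zero_iff, mem_ball_zero_iff, hscale, hscale2,
        div_lt_one hr, div_lt_iff₀' (by positivity)]
      exact ⟨hp1.1, hp2.2⟩)
    exact ⟨_, HasStrictFDerivAt.comp
      (f := fun p : ℂ × ℂ => ((((r ^ 2)⁻¹ : ℝ) : ℂ) * p.1, ((r⁻¹ : ℝ) : ℂ) * p.2)) p hX'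
      ((hasStrictFDerivAt_fst.const_mul _).prodMk (hasStrictFDerivAt_snd.const_mul _))⟩
  · intro t
    simp only [mul_zero, ← Complex.ofReal_mul]
    exact hX0 _
  · intro t ht z hz
    rw [lt_min_iff] at ht hz
    obtain ⟨q, hq, h⟩ := hXu ((r ^ 2)⁻¹ * t) (by
      rw [abs_mul, abs_of_nonneg (by positivity : 0 ≤ (r ^ 2)⁻¹), inv_mul_lt_iff₀ (by positivity)]
      exact ht.1) (((r⁻¹ : ℝ) : ℂ) * z) (by rw [hscale, div_lt_one hr]; exact hz.2)
    have hrz : (r : ℂ) * (((r⁻¹ : ℝ) : ℂ) * z) = z := by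
      rw [← mul_assoc, ← Complex.ofReal_mul, mul_inv_cancel₀ hr.ne', Complex.ofReal_one, one_mul]
    rw [hscale] at h
    simp only [hrz] at h
    refine ⟨q / r ^ 2, ?_, ?_⟩
    · rw [abs_div, abs_of_pos (by positivity : 0 < r ^ 2)]
      gcongr
    · rw [Complex.ofReal_mul] at h
      refine h.trans ?_
      rw [div_pow]
      congr 1
      field_simp

/-! ### From the potential to the univalent map. -/

/-- With `m = μ(z)` the left side is `|h|²`. By `1 + x ≤ exp x`, the exponential factor is too close
to `1` to carry `m` across `t`. -/
theorem mul_exp_lt_iff {m t q C : ℝ} (hm : 0 ≤ m) (ht : 0 < t) (hq : |q| ≤ C) (hCm : C * m < 1)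
    (hCt : C * t < 1) : m * Real.exp (-((m - t) * q)) < t ↔ m < t := by
  obtain ⟨hq1, hq2⟩ := abs_le.1 hq
  constructor
  · intro h
    by_contra! hmt
    have h1 : -((m - t) * q) ≥ -((m - t) * C) := by nlinarith
    have h2 := Real.add_one_le_exp (-((m - t) * q))
    have h3 : m * (1 - (m - t) * C) ≤ m * Real.exp (-((m - t) * q)) := by gcongr; linarith
    nlinarith [mul_nonneg (sub_nonneg.2 hmt) (sub_nonneg.2 hCm.le)]
  · intro hmt
    have h1 : -((t - m) * C) ≤ (m - t) * q := by nlinarith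
    have h2 := Real.add_one_le_exp ((m - t) * q)
    have h3 : m < t * Real.exp ((m - t) * q) := by
      have : t * (1 - (t - m) * C) ≤ t * Real.exp ((m - t) * q) := by gcongr; linarith
      nlinarith [mul_pos (sub_pos.2 hmt) (sub_pos.2 hCt)]
    rw [Real.exp_neg, ← div_eq_mul_inv, div_lt_iff₀ (Real.exp_pos _)]
    exact h3

theorem norm_mul_cexp_lt_iff {z x : ℂ} {u q t C ε : ℝ} (hε : 0 < ε) (ht : t = ε ^ 2)
    (hq : |q| ≤ C) (hu : u = 2 * x.re + (Real.exp u * ‖z‖ ^ 2 - t) * q)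
    (hCm : C * (Real.exp u * ‖z‖ ^ 2) < 1) (hCt : C * t < 1) :
    ‖z * Complex.exp x‖ < ε ↔ Real.exp u * ‖z‖ ^ 2 < t := by
  have ht0 : 0 < t := ht ▸ by positivity
  rw [← mul_exp_lt_iff (by positivity) ht0 hq hCm hCt,
    ← pow_lt_pow_iff_left₀ (norm_nonneg _) hε.le two_ne_zero, ← ht]
  have : ‖z * Complex.exp x‖ ^ 2 =
      Real.exp u * ‖z‖ ^ 2 * Real.exp (-((Real.exp u * ‖z‖ ^ 2 - t) * q)) := by
    rw [norm_mul, Complex.norm_exp, mul_pow, ← Real.exp_nat_mul, mul_right_comm, ← Real.exp_add,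
      mul_comm]
    congr 2
    push_cast
    linarith
  rw [this]

/-- The map `(t, z) ↦ z * exp (X (t, z))` has strict derivative `exp (X 0)` times the second
projection at the origin. Strictness compares two points with the same `t`, so one `η` serves all
slices. -/
theorem HasStrictFDerivAt.exists_approximatesLinearOn_slice {X : ℂ × ℂ → ℂ} {X' : ℂ × ℂ →L[ℂ] ℂ}
    (hX : HasStrictFDerivAt X X' 0) :
    ∃ η > 0, ∀ t : ℂ, ‖t‖ < η → ApproximatesLinearOn
      (fun z => (Complex.exp (X 0))⁻¹ * (z * Complex.exp (X (t, z))))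
      (ContinuousLinearMap.id ℂ ℂ) (Metric.ball 0 η) (1 / 2) := by
  have hd := ((hasStrictFDerivAt_snd (𝕜 := ℂ) (p := (0 : ℂ × ℂ))).mul hX.cexp).const_mul
    (Complex.exp (X 0))⁻¹
  obtain ⟨s, hs, happ⟩ := hd.approximates_deriv_on_nhds (c := 1 / 2)
    (Or.inr (by norm_num))
  obtain ⟨η, hη, hηs⟩ := Metric.mem_nhds_iff.1 hs
  refine ⟨η, hη, fun t ht x hx y hy => ?_⟩
  have hmem : ∀ z ∈ Metric.ball (0 : ℂ) η, (t, z) ∈ s := fun z hz => hηs (by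
    rw [mem_ball_zero_iff] at hz ⊢
    exact max_lt ht hz)
  have h := happ _ (hmem x hx) _ (hmem y hy)
  have hn : ‖((t, x) : ℂ × ℂ) - (t, y)‖ = ‖x - y‖ := by simp
  rw [hn] at h
  convert h using 2
  simp [Complex.exp_ne_zero]

theorem theorem4p1 (U : Set ℂ) (hU : IsOpen U) (h0U : (0 : ℂ) ∈ U)
    (k μ : ℂ → ℝ) (hk_analytic : AnalyticOnNhd ℝ k U) (hk_pos : ∀ z ∈ U, 0 < k z)
    (hμ : ∀ z ∈ U, μ z = k z * ‖z‖ ^ 2) :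
    ∃ R₁ R₂ : ℝ, 0 < R₁ ∧ 0 < R₂ ∧ Metric.ball (0 : ℂ) R₂ ⊆ U ∧
      ∃ h : ℂ → ℂ → ℂ,
        DifferentiableOn ℂ (fun p : ℂ × ℂ => h p.1 p.2)
          (Metric.ball (0 : ℂ) R₁ ×ˢ Metric.ball (0 : ℂ) R₂) ∧
        (∀ ε : ℝ, 0 < ε → ε < R₁ →
          sublevelDomain U μ ε = {z : ℂ | ‖z‖ < R₂ ∧ μ z < ε ^ 2} ∧
          IsNormalizedUnivalent (h (ε : ℂ)) (sublevelDomain U μ ε) ε ∧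
          ∀ g : ℂ → ℂ, IsNormalizedUnivalent g (sublevelDomain U μ ε) ε →
            EqOn g (h (ε : ℂ)) (sublevelDomain U μ ε)) ∧
        ∀ ε z : ℂ, ‖ε‖ < R₁ → ‖z‖ < R₂ → h (-ε) z = h ε z := by
  obtain ⟨δ, C₀, hδ, X, hX, hX0, hXu⟩ :=
    AnalyticAt.exists_conformal_potential (u := fun z => Real.log (k z))
      ((analyticAt_log (hk_pos 0 h0U)).comp (hk_analytic 0 h0U))
  obtain ⟨C, hC0, hC⟩ : ∃ C, 0 < C ∧ C₀ ≤ C :=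
    ⟨|C₀| + 1, by positivity, by linarith [le_abs_self C₀]⟩
  obtain ⟨X', hX'⟩ := hX 0 ⟨Metric.mem_ball_self hδ, Metric.mem_ball_self hδ⟩
  obtain ⟨η, hη, happ⟩ := hX'.exists_approximatesLinearOn_slice
  obtain ⟨ρ, hρ, hρU⟩ : ∃ ρ > 0, ∀ z : ℂ, ‖z‖ < ρ → z ∈ U ∧ C * (k z * ‖z‖ ^ 2) < 1 := by
    have hcont : ContinuousAt (fun z => C * (k z * ‖z‖ ^ 2)) 0 := by
      have := (hk_analytic 0 h0U).continuousAt
      fun_prop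
    have hev := (hU.eventually_mem h0U).and
      (hcont.eventually_lt (continuousAt_const (y := (1 : ℝ))) (by simp))
    obtain ⟨ρ, hρ, h⟩ := Metric.eventually_nhds_iff.1 hev
    exact ⟨ρ, hρ, fun z hz => h (by simpa using hz)⟩
  set c := Complex.exp (X 0) with hc
  have hc0 : 0 < ‖c‖ := norm_pos_iff.2 (Complex.exp_ne_zero _)
  obtain ⟨R₂, hR₂, hR₂δ, hR₂η, hR₂ρ⟩ : ∃ R₂, 0 < R₂ ∧ R₂ ≤ δ ∧ R₂ ≤ η ∧ R₂ ≤ ρ :=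
    ⟨min δ (min η ρ), by positivity, min_le_left _ _, (min_le_right _ _).trans (min_le_left _ _),
      (min_le_right _ _).trans (min_le_right _ _)⟩
  -- `R₁ ≤ 1` keeps `ε²` below `R₁`; the last bound puts the disk of radius `ε / ‖c‖` inside the
  -- image of the `R₂`-ball.
  obtain ⟨R₁, hR₁, hR₁1, hR₁δ, hR₁η, hR₁C, hR₁c⟩ : ∃ R₁, 0 < R₁ ∧ R₁ ≤ 1 ∧ R₁ ≤ δ ∧ R₁ ≤ η ∧
      R₁ ≤ 1 / C ∧ R₁ ≤ ‖c‖ * (R₂ / 4) := by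
    refine ⟨min 1 (min δ (min η (min (1 / C) (‖c‖ * (R₂ / 4))))), by positivity, ?_⟩
    simp
  have hsq : ∀ ε : ℂ, ‖ε‖ < R₁ → ‖ε ^ 2‖ < R₁ := fun ε hε => by
    rw [norm_pow]
    exact (pow_le_of_le_one (norm_nonneg _) (hε.le.trans hR₁1) two_ne_zero).trans_lt hε
  have hXd : ∀ ε z : ℂ, ‖ε‖ < R₁ → ‖z‖ < R₂ → DifferentiableAt ℂ X (ε ^ 2, z) := by
    intro ε z hε hz
    obtain ⟨D, hD⟩ := hX (ε ^ 2, z) ⟨by simpa using (hsq ε hε).trans_le hR₁δ,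
      by simpa using hz.trans_le hR₂δ⟩
    exact hD.hasFDerivAt.differentiableAt
  have hhd : ∀ ε z : ℂ, ‖ε‖ < R₁ → ‖z‖ < R₂ →
      DifferentiableAt ℂ (fun p : ℂ × ℂ => p.2 * Complex.exp (X (p.1 ^ 2, p.2))) (ε, z) := by
    intro ε z hε hz
    have hin : DifferentiableAt ℂ (fun p : ℂ × ℂ => (p.1 ^ 2, p.2)) (ε, z) := by fun_prop
    have := DifferentiableAt.comp (f := fun p : ℂ × ℂ => (p.1 ^ 2, p.2)) (ε, z)
      (hXd ε z hε hz) hin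
    exact differentiableAt_snd.mul this.cexp
  refine ⟨R₁, R₂, hR₁, hR₂, fun z hz => (hρU z (by
    rw [mem_ball_zero_iff] at hz; exact hz.trans_le hR₂ρ)).1,
    fun ε z => z * Complex.exp (X (ε ^ 2, z)), ?_, ?_, fun ε z _ _ => by simp only [neg_sq]⟩
  · rintro ⟨ε, z⟩ ⟨hε, hz⟩
    rw [mem_ball_zero_iff] at hε hz
    exact (hhd ε z hε hz).differentiableWithinAt
  intro ε hε hεR
  have hεn : ‖(ε : ℂ)‖ < R₁ := by rwa [Complex.norm_real, Real.norm_of_nonneg hε.le]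
  have hεsq : ‖(ε : ℂ) ^ 2‖ < R₁ := hsq _ hεn
  have hεabs : |ε ^ 2| < R₁ := by
    rwa [← Complex.ofReal_pow, Complex.norm_real] at hεsq
  set h : ℂ → ℂ := fun z => z * Complex.exp (X ((ε : ℂ) ^ 2, z)) with hh
  have hdiff : ∀ z : ℂ, ‖z‖ < R₂ → DifferentiableAt ℂ h z := fun z hz =>
    DifferentiableAt.comp (f := fun z : ℂ => ((ε : ℂ), z)) z (hhd ε z hεn hz) (by fun_prop)
  have happ' : ApproximatesLinearOn (fun z => c⁻¹ * h z) (ContinuousLinearMap.id ℂ ℂ)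
      (Metric.ball 0 R₂) (1 / 2) :=
    (happ _ (hεsq.trans_le hR₁η)).mono_set (Metric.ball_subset_ball hR₂η)
  have hf0 : c⁻¹ * h 0 = 0 := by simp [hh]
  have hs : ε / ‖c‖ ≤ R₂ / 4 := by
    rw [div_le_iff₀' hc0]
    exact hεR.le.trans hR₁c
  have hnorm : ∀ z, ‖c⁻¹ * h z‖ < ε / ‖c‖ ↔ ‖h z‖ < ε := fun z => by
    rw [norm_mul, norm_inv, inv_mul_eq_div, div_lt_div_iff_of_pos_right hc0]
  have hiff : ∀ z : ℂ, ‖z‖ < R₂ → (‖h z‖ < ε ↔ μ z < ε ^ 2) := by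
    intro z hz
    obtain ⟨hzU, hCz⟩ := hρU z (hz.trans_le hR₂ρ)
    obtain ⟨q, hq, hu⟩ := hXu (ε ^ 2) (hεabs.trans_le hR₁δ) z (hz.trans_le hR₂δ)
    have hexp : Real.exp (Real.log (k z)) = k z := Real.exp_log (hk_pos z hzU)
    rw [Complex.ofReal_pow] at hu
    rw [hμ z hzU]
    have hCε : C * ε ^ 2 < 1 := by
      have : ε ^ 2 < 1 / C := (le_abs_self _).trans_lt (hεabs.trans_le hR₁C)
      rwa [lt_div_iff₀' hC0] at this
    have := norm_mul_cexp_lt_iff hε rfl (hq.trans hC) hu (by rwa [hexp]) hCε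
    rwa [hexp] at this
  have hS : {z : ℂ | ‖z‖ < R₂ ∧ ‖c⁻¹ * h z‖ < ε / ‖c‖} = {z : ℂ | ‖z‖ < R₂ ∧ μ z < ε ^ 2} := by
    ext z
    simp only [mem_ofPred_eq, hnorm]
    exact and_congr_right fun hz => hiff z hz
  have hFV : {z : ℂ | z ∈ U ∧ μ z < ε ^ 2} ∩ Metric.ball 0 R₂ =
      {z : ℂ | ‖z‖ < R₂ ∧ μ z < ε ^ 2} := by
    ext z
    simp only [mem_inter_iff, mem_ofPred_eq, mem_ball_zero_iff]
    exact ⟨fun hz => ⟨hz.2, hz.1.2⟩, fun hz => ⟨⟨(hρU z (hz.1.trans_le hR₂ρ)).1, hz.2⟩, hz.1⟩⟩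
  have hpre := happ'.isPreconnected_sublevel hf0 hR₂ hs
  rw [hS] at hpre
  have h0S : (0 : ℂ) ∈ {z : ℂ | ‖z‖ < R₂ ∧ μ z < ε ^ 2} := by
    refine ⟨by simpa using hR₂, ?_⟩
    rw [hμ 0 h0U]
    simpa using pow_pos hε 2
  have hE : sublevelDomain U μ ε = {z : ℂ | ‖z‖ < R₂ ∧ μ z < ε ^ 2} := by
    rw [← hFV] at hpre h0S ⊢
    -- `‖z‖ ≤ 2 ‖c⁻¹ * h z‖ < 2 * (R₂ / 4)` confines the sublevel set to the closed ball of radius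
    -- `R₂ / 2`.
    refine connectedComponentIn_eq_inter_of_subset_isClosed Metric.isOpen_ball
      (Metric.isClosed_closedBall (x := (0 : ℂ)) (ε := R₂ / 2)) h0S hpre ?_
      (Metric.closedBall_subset_ball (by linarith))
    rw [hFV, ← hS]
    rintro z ⟨hz, hz'⟩
    have := happ'.norm_le_two_mul_norm hf0 hz
    rw [mem_closedBall_zero_iff]
    linarith
  rw [hE]
  have hSo : IsOpen {z : ℂ | ‖z‖ < R₂ ∧ μ z < ε ^ 2} := by
    rw [← hS]
    have := happ'.continuousOn.norm.isOpen_inter_preimage Metric.isOpen_ball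
      (isOpen_Iio (a := ε / ‖c‖))
    convert this using 1
    ext z
    simp
  have hun : IsNormalizedUnivalent h {z : ℂ | ‖z‖ < R₂ ∧ μ z < ε ^ 2} ε := by
    refine ⟨fun z hz => (hdiff z hz.1).differentiableWithinAt, fun x hx y hy hxy => ?_, ?_, ?_, ?_⟩
    · exact happ'.injOn_ball (by simpa using hx.1) (by simpa using hy.1)
        (congrArg (c⁻¹ * ·) hxy)
    · have himg := happ'.image_sublevel hf0 hR₂ hs
      rw [hS] at himg
      ext w
      constructor
      · rintro ⟨z, hz, rfl⟩
        rw [mem_ball_zero_iff]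
        exact (hiff z hz.1).2 hz.2
      · intro hw
        have hw' : c⁻¹ * w ∈ Metric.ball (0 : ℂ) (ε / ‖c‖) := by
          rw [mem_ball_zero_iff] at hw ⊢
          rwa [norm_mul, norm_inv, inv_mul_eq_div, div_lt_div_iff_of_pos_right hc0]
        rw [← himg] at hw'
        obtain ⟨z, hz, hzw⟩ := hw'
        exact ⟨z, hz, mul_left_cancel₀ (inv_ne_zero (Complex.exp_ne_zero _)) hzw⟩
    · simp [hh]
    · refine ⟨Real.exp (X ((ε : ℂ) ^ 2, 0)).re, Real.exp_pos _, ?_⟩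
      have him : (((X ((ε : ℂ) ^ 2, 0)).re : ℝ) : ℂ) = X ((ε : ℂ) ^ 2, 0) := by
        refine Complex.ext (Complex.ofReal_re _) ?_
        rw [Complex.ofReal_im, ← Complex.ofReal_pow, hX0]
      have hX1 : DifferentiableAt ℂ (fun z : ℂ => X ((ε : ℂ) ^ 2, z)) 0 :=
        DifferentiableAt.comp (f := fun z : ℂ => ((ε : ℂ) ^ 2, z)) 0
          (hXd ε 0 hεn (by simpa using hR₂)) (by fun_prop)
      have := (hasDerivAt_id (0 : ℂ)).mul hX1.cexp.hasDerivAt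
      rw [Complex.ofReal_exp, him]
      simpa using! this
  exact ⟨rfl, hun, fun g hg => hg.eqOn hSo hpre h0S hun⟩
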